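/- Let $D$ be an integral domain with quotient field $K$. A *semistar operation* on $D$ is a map $E\mapsto E^\star$ on the set of nonzero $D$-submodules of $K$ such that, for all nonzero $x\in K$ and all nonzero $D$-submodules $E,F$ of $K$: $(xE)^\star=xE^\star$; $E\subseteq F$ implies $E^\star\subseteq F^\star$; $E\subseteq E^\star$ and $(E^\star)^\star=E^\star$. Its associated finite-type semistar operation is $E^{\star_f}=\bigcup\{F^\star : F\subseteq E,\ F \text{ a nonzero finitely generated } D\text{-submodule of } K\}$. For $A,B\subseteq K$ put $(A:B)=\{x\in K : xB\subseteq A\}$. A nonzero ideal $I$ of $D$ is a *quasi-$\star_f$-ideal* if $I=I^{\star_f}\cap D$; a *quasi-$\star_f$-prime* is a prime quasi-$\star_f$-ideal; a *quasi-$\star_f$-maximal* ideal is a maximal element of the set of proper quasi-$\star_f$-ideals. A nonzero ideal $I$ is *$\star_f$-idempotent* if $I^{\star_f}=(I^2)^{\star_f}$, and *$\star_f$-divisorial* if $I^{\star_f}$ is divisorial in $D^\star$, i.e. $(D^\star:(D^\star:I^{\star_f}))=I^{\star_f}$. An ideal $I$ is a *$\star_f$-product* of ideals $P_1,\dots,P_n$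 ($n\ge 0$, the empty product being $D$) if $I^{\star_f}=(P_1\cdots P_n)^{\star_f}$. $D$ is a *P$\star$MD* if $(F(D:F))^{\star_f}=D^{\star_f}$ for every nonzero finitely generated $D$-submodule $F$ of $K$, and it has *finite $\star_f$-character* if every nonzero element of $D$ lies in only finitely many quasi-$\star_f$-maximal ideals. **Statement.** Let $\star$ be a semistar operation on $D$ such that $D$ is a P$\star$MD with finite $\star_f$-character, and let $I$ be a quasi-$\star_f$-ideal of $D$. Then: 1. $I$ is $\star_f$-idempotent if and only if $I$ is a $\star_f$-product of $\star_f$-idempotent quasi-$\star_f$-prime ideals of $D$. 2. The following statements are equivalent: (a) $I$ is $\star_f$-idempotent and $\star_f$-divisorial. (b) $I$ is a $\star_f$-product of $\star_f$-idempotent quasi-$\star_f$-prime ideals that are not quasi-$\star_f$-maximal. (c) $I$ is a $\star_f$-product of $\star_f$-divisorial $\star_f$-idempotent nonzero prime ideals. (d) $I$ has a unique (up to order) representation as a $\star_f$-product of pairwise incomparable $\star_f$-divisorial $\star_f$-idempotent quasi-$\star_f$-primes. -/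

import Mathlib

open scoped Pointwise

/-- A semistar operation on the integral domain `D` with quotient field `K`: a closure operation
`E ↦ E^⋆` on the nonzero `D`-submodules of `K`, compatible with multiplication by nonzero elements
of `K`.  The underlying function is total, but only its values at nonzero submodules are
constrained; no notion below ever evaluates it at `⊥` in a way that matters. -/
structure SemistarOperation (D K : Type*) [CommRing D] [IsDomain D] [Field K] [Algebra D K]
    [IsFractionRing D K] where
  /-- the map `E ↦ E^⋆` -/
  cl : Submodule D K → Submodule D K
  cl_smul : ∀ (x : K) (E : Submodule D K), x ≠ 0 → E ≠ ⊥ → cl (x • E) = x • cl E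
  cl_mono : ∀ E F : Submodule D K, E ≠ ⊥ → F ≠ ⊥ → E ≤ F → cl E ≤ cl F
  le_cl : ∀ E : Submodule D K, E ≠ ⊥ → E ≤ cl E
  cl_cl : ∀ E : Submodule D K, E ≠ ⊥ → cl (cl E) = cl E

namespace SemistarOperation

variable {D K : Type*} [CommRing D] [IsDomain D] [Field K] [Algebra D K] [IsFractionRing D K]

/-- The submodule `⋃ {F^⋆ | F nonzero finitely generated, F ⊆ E}`, written as a supremum; it is the
union for nonzero `E`, see `mem_finCl`. -/
def finCl (s : SemistarOperation D K) (E : Submodule D K) : Submodule D K :=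
  ⨆ F : {F : Submodule D K // F.FG ∧ F ≠ ⊥ ∧ F ≤ E}, s.cl F.1

theorem mem_finCl (s : SemistarOperation D K) {E : Submodule D K} (hE : E ≠ ⊥) (x : K) :
    x ∈ s.finCl E ↔ ∃ F : Submodule D K, F.FG ∧ F ≠ ⊥ ∧ F ≤ E ∧ x ∈ s.cl F := by
  obtain ⟨e, he, he0⟩ := Submodule.exists_mem_ne_zero_of_ne_bot hE
  have : Nonempty {F : Submodule D K // F.FG ∧ F ≠ ⊥ ∧ F ≤ E} :=
    ⟨⟨Submodule.span D {e}, Submodule.fg_span_singleton e,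
      by simpa [Submodule.span_singleton_eq_bot] using he0,
      by simpa [Submodule.span_singleton_le_iff_mem] using he⟩⟩
  unfold finCl
  rw [Submodule.mem_iSup_of_directed]
  · constructor
    · rintro ⟨⟨F, h1, h2, h3⟩, hx⟩
      exact ⟨F, h1, h2, h3, hx⟩
    · rintro ⟨F, h1, h2, h3, hx⟩
      exact ⟨⟨F, h1, h2, h3⟩, hx⟩
  · rintro ⟨F, h1, h2, h3⟩ ⟨G, g1, g2, g3⟩
    have hne : F ⊔ G ≠ ⊥ := fun h => h2 (le_bot_iff.1 (h ▸ le_sup_left))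
    exact ⟨⟨F ⊔ G, h1.sup g1, hne, sup_le h3 g3⟩,
      s.cl_mono _ _ h2 hne le_sup_left, s.cl_mono _ _ g2 hne le_sup_right⟩

theorem finCl_mono (s : SemistarOperation D K) {E F : Submodule D K} (h : E ≤ F) :
    s.finCl E ≤ s.finCl F :=
  iSup_le fun G => le_iSup_of_le
    (⟨G.1, G.2.1, G.2.2.1, G.2.2.2.trans h⟩ :
      {G : Submodule D K // G.FG ∧ G ≠ ⊥ ∧ G ≤ F}) le_rfl

theorem le_finCl (s : SemistarOperation D K) {E : Submodule D K} (hE : E ≠ ⊥) :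
    E ≤ s.finCl E := by
  intro x hx
  rw [s.mem_finCl hE]
  by_cases h0 : x = 0
  · obtain ⟨e, he, he0⟩ := Submodule.exists_mem_ne_zero_of_ne_bot hE
    refine ⟨Submodule.span D {e}, Submodule.fg_span_singleton e,
      by simpa [Submodule.span_singleton_eq_bot] using he0,
      by simpa [Submodule.span_singleton_le_iff_mem] using he, ?_⟩
    rw [h0]
    exact zero_mem _
  · have hb : Submodule.span D {x} ≠ ⊥ := by
      simpa [Submodule.span_singleton_eq_bot] using h0
    exact ⟨Submodule.span D {x}, Submodule.fg_span_singleton x, hb,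
      by simpa [Submodule.span_singleton_le_iff_mem] using hx,
      s.le_cl _ hb (Submodule.mem_span_singleton_self x)⟩

theorem smul_ne_bot {x : K} {E : Submodule D K} (hx : x ≠ 0) (hE : E ≠ ⊥) : x • E ≠ ⊥ := by
  obtain ⟨e, he, he0⟩ := Submodule.exists_mem_ne_zero_of_ne_bot hE
  intro h
  have h1 : x • e ∈ x • E := Submodule.smul_mem_pointwise_smul e x E he
  rw [h, Submodule.mem_bot] at h1
  exact (mul_ne_zero hx he0) h1

theorem smul_finCl_le (s : SemistarOperation D K) {x : K} {E : Submodule D K} (hx : x ≠ 0)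
    (hE : E ≠ ⊥) : x • s.finCl E ≤ s.finCl (x • E) := by
  intro y hy
  obtain ⟨z, hz, rfl⟩ := (Submodule.mem_smul_pointwise_iff_exists y x _).1 hy
  obtain ⟨F, h1, h2, h3, h4⟩ := (s.mem_finCl hE z).1 hz
  refine (s.mem_finCl (smul_ne_bot hx hE) _).2
    ⟨x • F, h1.map _, smul_ne_bot hx h2, Submodule.map_mono h3, ?_⟩
  rw [s.cl_smul x F hx h2]
  exact Submodule.smul_mem_pointwise_smul z x _ h4

/-- The finite-type semistar operation `⋆_f` associated with `⋆`. -/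
def fin (s : SemistarOperation D K) : SemistarOperation D K where
  cl := s.finCl
  cl_smul x E hx hE := by
    refine le_antisymm ?_ (s.smul_finCl_le hx hE)
    have h := s.smul_finCl_le (inv_ne_zero hx) (smul_ne_bot hx hE)
    rw [smul_smul, inv_mul_cancel₀ hx, one_smul] at h
    have h2 : x • (x⁻¹ • s.finCl (x • E)) ≤ x • s.finCl E := Submodule.map_mono h
    rwa [smul_smul, mul_inv_cancel₀ hx, one_smul] at h2
  cl_mono _ _ _ _ h := s.finCl_mono h
  le_cl _ hE := s.le_finCl hE
  cl_cl E hE := by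
    have hne : s.finCl E ≠ ⊥ := fun h => hE (le_bot_iff.1 (h ▸ s.le_finCl hE))
    refine le_antisymm (iSup_le ?_) (s.le_finCl hne)
    rintro ⟨F, hF, hF0, hFE⟩
    have key : ∀ G : Submodule D K, G.FG → G ≤ s.finCl E →
        ∃ H : Submodule D K, H.FG ∧ H ≠ ⊥ ∧ H ≤ E ∧ G ≤ s.cl H := by
      intro G hG
      induction G, hG using Submodule.fg_induction with
      | singleton x =>
        intro hx
        obtain ⟨H, h1, h2, h3, h4⟩ := (s.mem_finCl hE x).1
          (hx (Submodule.mem_span_singleton_self x))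
        exact ⟨H, h1, h2, h3, by simpa [Submodule.span_singleton_le_iff_mem] using h4⟩
      | sup G₁ G₂ _ _ ih₁ ih₂ =>
        intro h
        obtain ⟨H₁, a1, a2, a3, a4⟩ := ih₁ (le_sup_left.trans h)
        obtain ⟨H₂, b1, b2, b3, b4⟩ := ih₂ (le_sup_right.trans h)
        have hb : H₁ ⊔ H₂ ≠ ⊥ := fun h => a2 (le_bot_iff.1 (h ▸ le_sup_left))
        exact ⟨H₁ ⊔ H₂, a1.sup b1, hb, sup_le a3 b3,
          sup_le (a4.trans (s.cl_mono _ _ a2 hb le_sup_left))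
            (b4.trans (s.cl_mono _ _ b2 hb le_sup_right))⟩
    obtain ⟨H, h1, h2, h3, h4⟩ := key F hF hFE
    have hH : s.cl H ≠ ⊥ := fun h => h2 (le_bot_iff.1 (h ▸ s.le_cl H h2))
    have h5 : s.cl F ≤ s.cl H := (s.cl_mono _ _ hF0 hH h4).trans (s.cl_cl H h2).le
    exact h5.trans (le_iSup_of_le
      (⟨H, h1, h2, h3⟩ : {F : Submodule D K // F.FG ∧ F ≠ ⊥ ∧ F ≤ E}) le_rfl)

/-- `I^⋆`, for an ideal `I` of `D` viewed as a `D`-submodule of `K`. -/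
def idealCl (s : SemistarOperation D K) (I : Ideal D) : Submodule D K :=
  s.cl (IsLocalization.coeSubmodule K I)

/-- `I` is a quasi-`⋆`-ideal: `I ≠ 0` and `I^⋆ ∩ D = I`. -/
def IsQuasiIdeal (s : SemistarOperation D K) (I : Ideal D) : Prop :=
  I ≠ ⊥ ∧ (s.idealCl I).comap (Algebra.linearMap D K) = I

/-- `P` is a quasi-`⋆`-prime ideal. -/
def IsQuasiPrime (s : SemistarOperation D K) (P : Ideal D) : Prop :=
  P.IsPrime ∧ s.IsQuasiIdeal P

/-- `M` is a quasi-`⋆`-maximal ideal: maximal among the proper quasi-`⋆`-ideals. -/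
def IsQuasiMaximal (s : SemistarOperation D K) (M : Ideal D) : Prop :=
  Maximal (fun J : Ideal D => J ≠ ⊤ ∧ s.IsQuasiIdeal J) M

/-- `I` is `⋆`-idempotent: `I^⋆ = (I²)^⋆`. -/
def IsIdempotentIdeal (s : SemistarOperation D K) (I : Ideal D) : Prop :=
  s.idealCl I = s.idealCl (I ^ 2)

/-- `I` is `⋆_f`-divisorial: `I^{⋆_f}` is a divisorial ideal of `D^⋆`, that is,
`(D^⋆ : (D^⋆ : I^{⋆_f})) = I^{⋆_f}` (here `A / B = {x ∈ K | x B ⊆ A}` and `1` is `D`). -/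
def IsFinDivisorial (s : SemistarOperation D K) (I : Ideal D) : Prop :=
  s.cl 1 / (s.cl 1 / s.fin.idealCl I) = s.fin.idealCl I

/-- `D` is a Prüfer `⋆`-multiplication domain: `(F F⁻¹)^{⋆_f} = D^{⋆_f}` for every nonzero finitely
generated `D`-submodule `F` of `K`, where `F⁻¹ = (D : F)`. -/
def IsPruferMultiplicationDomain (s : SemistarOperation D K) : Prop :=
  ∀ F : Submodule D K, F.FG → F ≠ ⊥ → s.fin.cl (F * (1 / F)) = s.fin.cl 1

/-- `D` has finite `⋆`-character: every nonzero element of `D` lies in only finitely many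
quasi-`⋆`-maximal ideals. -/
def HasFiniteCharacter (s : SemistarOperation D K) : Prop :=
  ∀ d : D, d ≠ 0 → {M : Ideal D | s.IsQuasiMaximal M ∧ d ∈ M}.Finite

/-- `I` is a `⋆`-product of ideals satisfying `C`: `I^⋆ = (P₁ ⋯ Pₙ)^⋆` with every `Pᵢ` satisfying
`C`.  The empty product `n = 0` is the ideal `D`. -/
def IsStarProductOf (s : SemistarOperation D K) (C : Ideal D → Prop) (I : Ideal D) : Prop :=
  ∃ (n : ℕ) (P : Fin n → Ideal D), (∀ i, C (P i)) ∧ s.idealCl I = s.idealCl (∏ i, P i)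

end SemistarOperation

set_option linter.unusedSectionVars false

namespace SemistarOperation

open IsLocalization (coeSubmodule)

variable {D K : Type*} [CommRing D] [IsDomain D] [Field K] [Algebra D K] [IsFractionRing D K]

/-! In a P⋆MD the operation `⋆_f` is local: `E^{⋆_f}` is the intersection of the `E D_M` over the
quasi-maximal `M` (`mem_cl_iff`), and every `D_M` is a valuation ring (`exists_dvd_or_dvd`). So
`⋆_f`-equalities are checked one `M` at a time.

A proper idempotent ideal of a valuation ring is prime, so an idempotent `I` becomes a prime `P_M
D_M` at each `M ⊇ I`. By finite character there are finitely many such `M`, and distinct `P_M` never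
lie in a common quasi-maximal ideal. Hence `I` is locally, and therefore globally, the `⋆_f`-product
of the distinct `P_M` (`exists_finset_prod`). These are the minimal primes of `I`, which gives
uniqueness (`mem_minimalPrimes_iff`). Conversely, idempotence passes to products.

For divisoriality, an idempotent quasi-maximal ideal has trivial inverse (`mem_cl_one_of_mul_mem`),
so it cannot be a factor of a divisorial `I`. If instead every `P_M` lies strictly below `M`, finite
character supplies enough elements of `(D^⋆ : I)` to recover `I` (`isFinDivisorial_of_forall_lt`).
-/

theorem coeSubmodule_ne_bot {I : Ideal D} (hI : I ≠ ⊥) : coeSubmodule K I ≠ ⊥ := by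
  obtain ⟨d, hd, hd0⟩ := Submodule.exists_mem_ne_zero_of_ne_bot hI
  intro h
  have : algebraMap D K d ∈ coeSubmodule K I := ⟨d, hd, rfl⟩
  rw [h, Submodule.mem_bot] at this
  exact hd0 (IsFractionRing.injective D K (this.trans (map_zero _).symm))

theorem algebraMap_mem_coeSubmodule {I : Ideal D} {d : D} :
    algebraMap D K d ∈ coeSubmodule K I ↔ d ∈ I := by
  rw [IsLocalization.mem_coeSubmodule]
  exact ⟨fun ⟨x, hx, h⟩ => IsFractionRing.injective D K h ▸ hx, fun h => ⟨d, h, rfl⟩⟩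

theorem coeSubmodule_comap {A : Submodule D K} (hA : A ≤ 1) :
    coeSubmodule K (A.comap (Algebra.linearMap D K)) = A := by
  ext x
  rw [IsLocalization.mem_coeSubmodule]
  constructor
  · rintro ⟨d, hd, rfl⟩
    exact hd
  · intro hx
    obtain ⟨d, rfl⟩ := Submodule.mem_one.1 (hA hx)
    exact ⟨d, hx, rfl⟩

/-! ### Localizations at a prime, as submodules of `K` -/

section LocalRing

variable (K) (M : Ideal D) [hM : M.IsPrime]

/-- The localization of `D` at the prime ideal `M`, as a `D`-submodule of `K`. -/
def localRing : Submodule D K where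
  carrier := {x | ∃ t ∉ M, t • x ∈ (1 : Submodule D K)}
  add_mem' := by
    rintro x y ⟨t, ht, hx⟩ ⟨u, hu, hy⟩
    refine ⟨t * u, fun h => (hM.mem_or_mem h).elim ht hu, ?_⟩
    rw [smul_add]
    refine add_mem ?_ ?_
    · rw [mul_comm, mul_smul]
      exact Submodule.smul_mem _ _ hx
    · rw [mul_smul]
      exact Submodule.smul_mem _ _ hy
  zero_mem' := ⟨1, fun h => hM.ne_top ((Ideal.eq_top_iff_one _).2 h), by simp⟩
  smul_mem' := by
    rintro c x ⟨t, ht, hx⟩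
    exact ⟨t, ht, by rw [smul_comm]; exact Submodule.smul_mem _ _ hx⟩

/-- The localization of the ideal `I` at the prime ideal `M`, as a `D`-submodule of `K`. -/
def idealLoc (I : Ideal D) : Submodule D K :=
  coeSubmodule K I * localRing K M

variable {K M}

theorem mem_mul_localRing {E : Submodule D K} {x : K} :
    x ∈ E * localRing K M ↔ ∃ t ∉ M, t • x ∈ E := by
  constructor
  · intro hx
    induction hx using Submodule.mul_induction_on' with
    | mem_mul_mem e he y hy =>
      obtain ⟨t, ht, hy⟩ := hy
      obtain ⟨d, hd⟩ := Submodule.mem_one.1 hy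
      refine ⟨t, ht, ?_⟩
      rw [← mul_smul_comm, ← hd, mul_comm, ← Algebra.smul_def]
      exact Submodule.smul_mem _ _ he
    | add x _ y _ hx hy =>
      obtain ⟨t, ht, hx⟩ := hx
      obtain ⟨u, hu, hy⟩ := hy
      refine ⟨t * u, fun h => (hM.mem_or_mem h).elim ht hu, ?_⟩
      rw [smul_add]
      refine add_mem ?_ ?_
      · rw [mul_comm, mul_smul]
        exact Submodule.smul_mem _ _ hx
      · rw [mul_smul]
        exact Submodule.smul_mem _ _ hy
  · rintro ⟨t, ht, hx⟩
    have h0 : algebraMap D K t ≠ 0 := fun h =>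
      ht ((IsFractionRing.injective D K (h.trans (map_zero _).symm)) ▸ M.zero_mem)
    have : x = (t • x) * (algebraMap D K t)⁻¹ := by
      rw [Algebra.smul_def]; field_simp
    rw [this]
    refine Submodule.mul_mem_mul hx ⟨t, ht, ?_⟩
    rw [Algebra.smul_def, mul_inv_cancel₀ h0]
    exact Submodule.one_le.1 le_rfl

theorem localRing_mul_self : localRing K M * localRing K M = localRing K M := by
  ext x
  rw [mem_mul_localRing]
  constructor
  · rintro ⟨t, ht, u, hu, hx⟩
    exact ⟨u * t, fun h => (hM.mem_or_mem h).elim hu ht, by rwa [mul_smul]⟩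
  · intro hx
    exact ⟨1, fun h => hM.ne_top ((Ideal.eq_top_iff_one _).2 h), by rwa [one_smul]⟩

theorem idealLoc_mul (I J : Ideal D) : idealLoc K M (I * J) = idealLoc K M I * idealLoc K M J := by
  rw [idealLoc, IsLocalization.coeSubmodule_mul, idealLoc, idealLoc, mul_mul_mul_comm,
    localRing_mul_self]

theorem idealLoc_top : idealLoc K M ⊤ = localRing K M := by
  rw [idealLoc, IsLocalization.coeSubmodule_top, one_mul]

theorem idealLoc_mul_localRing (I : Ideal D) :
    idealLoc K M I * localRing K M = idealLoc K M I := by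
  rw [idealLoc, mul_assoc, localRing_mul_self]

theorem idealLoc_mono {I J : Ideal D} (h : I ≤ J) : idealLoc K M I ≤ idealLoc K M J :=
  mul_le_mul_left (IsLocalization.coeSubmodule_mono K h) _

theorem algebraMap_mem_idealLoc {I : Ideal D} {d : D} :
    algebraMap D K d ∈ idealLoc K M I ↔ ∃ t ∉ M, t * d ∈ I := by
  rw [idealLoc, mem_mul_localRing]
  simp only [Algebra.smul_def, ← map_mul, algebraMap_mem_coeSubmodule]

theorem algebraMap_mem_idealLoc_of_mem {I : Ideal D} {d : D} (h : d ∈ I) :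
    algebraMap D K d ∈ idealLoc K M I :=
  algebraMap_mem_idealLoc.2
    ⟨1, fun h => hM.ne_top ((Ideal.eq_top_iff_one _).2 h), by rwa [one_mul]⟩

theorem idealLoc_le_iff {I J : Ideal D} :
    idealLoc K M I ≤ idealLoc K M J ↔ ∀ d ∈ I, ∃ t ∉ M, t * d ∈ J := by
  constructor
  · intro h d hd
    exact algebraMap_mem_idealLoc.1 (h (algebraMap_mem_idealLoc_of_mem hd))
  · intro h x hx
    obtain ⟨t, ht, hx⟩ := mem_mul_localRing.1 hx
    obtain ⟨d, hd, hdx⟩ := (IsLocalization.mem_coeSubmodule _ _).1 hx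
    obtain ⟨u, hu, hud⟩ := h d hd
    refine mem_mul_localRing.2 ⟨u * t, fun h => (hM.mem_or_mem h).elim hu ht, ?_⟩
    rw [mul_smul, ← hdx, Algebra.smul_def, ← map_mul]
    exact algebraMap_mem_coeSubmodule.2 hud

theorem idealLoc_of_not_le {I : Ideal D} (h : ¬ I ≤ M) : idealLoc K M I = localRing K M := by
  rw [← idealLoc_top]
  refine le_antisymm (idealLoc_mono le_top) (idealLoc_le_iff.2 fun d _ => ?_)
  obtain ⟨t, ht, htM⟩ := SetLike.not_le_iff_exists.1 h
  exact ⟨t, htM, I.mul_mem_right _ ht⟩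

theorem algebraMap_mem_idealLoc_prime {P : Ideal D} [hP : P.IsPrime] (h : P ≤ M) {d : D} :
    algebraMap D K d ∈ idealLoc K M P ↔ d ∈ P := by
  refine ⟨fun hd => ?_, algebraMap_mem_idealLoc_of_mem⟩
  obtain ⟨t, ht, htd⟩ := algebraMap_mem_idealLoc.1 hd
  exact (hP.mem_or_mem htd).resolve_left fun h' => ht (h h')

/-- A product of ideals one of which is `P` and all others of which are not contained in `M`. -/
theorem idealLoc_prod_eq {S : Finset (Ideal D)} {P : Ideal D} (hP : P ∈ S)
    (h : ∀ Q ∈ S, Q ≤ M → Q = P) : idealLoc K M (∏ Q ∈ S, Q) = idealLoc K M P := by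
  classical
  rw [← Finset.mul_prod_erase S (fun Q => Q) hP, idealLoc_mul, idealLoc_of_not_le (I := ∏ Q ∈ _, Q),
    idealLoc_mul_localRing]
  intro hle
  obtain ⟨Q, hQ, hQM⟩ := (hM.prod_le).1 hle
  exact Finset.ne_of_mem_erase hQ (h Q (Finset.mem_of_mem_erase hQ) hQM)

end LocalRing

/-! ### Existence and primality of quasi-maximal ideals -/

section QuasiMaximal

variable (s : SemistarOperation D K)

theorem fin_cl_ne_bot {E : Submodule D K} (hE : E ≠ ⊥) : s.fin.cl E ≠ ⊥ :=
  fun h => hE (le_bot_iff.1 (h ▸ s.fin.le_cl E hE))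

theorem fin_cl_bot : s.fin.cl ⊥ = ⊥ :=
  le_bot_iff.1 (iSup_le fun F => (F.2.2.1 (le_bot_iff.1 F.2.2.2)).elim)

theorem fin_cl_one : s.fin.cl 1 = s.cl 1 := by
  refine le_antisymm (iSup_le fun F => s.cl_mono _ _ F.2.2.1 one_ne_zero F.2.2.2) ?_
  exact le_iSup_of_le (⟨1, by rw [Submodule.one_eq_span]; exact Submodule.fg_span_singleton 1, one_ne_zero, le_rfl⟩ :
    {F : Submodule D K // F.FG ∧ F ≠ ⊥ ∧ F ≤ 1}) le_rfl

theorem cl_le_cl_of_le {E F : Submodule D K} (hE : E ≠ ⊥) (hF : F ≠ ⊥) (h : E ≤ s.fin.cl F) :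
    s.fin.cl E ≤ s.fin.cl F :=
  (s.fin.cl_mono _ _ hE (s.fin_cl_ne_bot hF) h).trans (s.fin.cl_cl F hF).le

theorem mul_mem_cl {E F : Submodule D K} {x y : K} (hE : E ≠ ⊥) (hF : F ≠ ⊥)
    (h : x • E ≤ s.fin.cl F) (hy : y ∈ s.fin.cl E) : x * y ∈ s.fin.cl F := by
  by_cases hx : x = 0
  · rw [hx, zero_mul]; exact zero_mem _
  · refine s.cl_le_cl_of_le (smul_ne_bot hx hE) hF h ?_
    rw [s.fin.cl_smul x E hx hE]
    exact Submodule.smul_mem_pointwise_smul y x _ hy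

theorem isQuasiIdeal_of_le {I : Ideal D} (hI : I ≠ ⊥)
    (h : ∀ d, algebraMap D K d ∈ s.fin.idealCl I → d ∈ I) : s.fin.IsQuasiIdeal I :=
  ⟨hI, le_antisymm (fun d hd => h d hd) fun _ hd =>
    s.fin.le_cl _ (coeSubmodule_ne_bot hI) (algebraMap_mem_coeSubmodule.2 hd)⟩

variable {s}

theorem IsQuasiIdeal.mem {I : Ideal D} (h : s.fin.IsQuasiIdeal I) {d : D}
    (hd : algebraMap D K d ∈ s.fin.idealCl I) : d ∈ I :=
  h.2.le hd

theorem exists_isQuasiMaximal_ge {I : Ideal D} (hI : I ≠ ⊥) (h1 : (1 : K) ∉ s.fin.idealCl I) :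
    ∃ M, s.fin.IsQuasiMaximal M ∧ I ≤ M := by
  obtain ⟨M, hIM, hM⟩ := zorn_le_nonempty₀ {J : Ideal D | J ≠ ⊥ ∧ (1 : K) ∉ s.fin.idealCl J} (by
    intro c hc hchain J hJ
    refine ⟨sSup c, ⟨fun h => (hc hJ).1 (le_bot_iff.1 (h ▸ le_sSup hJ)), fun h => ?_⟩,
      fun _ => le_sSup⟩
    have hne : sSup c ≠ ⊥ := fun h => (hc hJ).1 (le_bot_iff.1 (h ▸ le_sSup hJ))
    -- Finite type makes the condition inductive: a finitely generated `F` witnessing `1` already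
    -- lies in one member of the chain.
    obtain ⟨F, hF, hF0, hFc, h1F⟩ := (s.mem_finCl (coeSubmodule_ne_bot hne) 1).1 h
    obtain ⟨J', hJ', hFJ⟩ : ∃ J' ∈ c, F ≤ coeSubmodule K J' := by
      clear h1F hF0
      induction F, hF using Submodule.fg_induction with
      | singleton x =>
        obtain ⟨d, hd, rfl⟩ := (IsLocalization.mem_coeSubmodule _ _).1
          (hFc (Submodule.mem_span_singleton_self x))
        obtain ⟨J', hJ', hd⟩ := (Submodule.mem_sSup_of_directed ⟨J, hJ⟩ hchain.directedOn).1 hd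
        exact ⟨J', hJ', (Submodule.span_singleton_le_iff_mem _ _).2
          (algebraMap_mem_coeSubmodule.2 hd)⟩
      | sup F G _ _ hF hG =>
        obtain ⟨J₁, hJ₁, h₁⟩ := hF (le_sup_left.trans hFc)
        obtain ⟨J₂, hJ₂, h₂⟩ := hG (le_sup_right.trans hFc)
        rcases hchain.total hJ₁ hJ₂ with h | h
        · exact ⟨J₂, hJ₂, sup_le (h₁.trans (IsLocalization.coeSubmodule_mono K h)) h₂⟩
        · exact ⟨J₁, hJ₁, sup_le h₁ (h₂.trans (IsLocalization.coeSubmodule_mono K h))⟩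
    exact (hc hJ').2 ((s.mem_finCl (coeSubmodule_ne_bot (hc hJ').1) 1).2 ⟨F, hF, hF0, hFJ, h1F⟩))
    I ⟨hI, h1⟩
  have hq : s.fin.IsQuasiIdeal M := by
    refine s.isQuasiIdeal_of_le hM.prop.1 fun d hd => ?_
    -- `N = M^{⋆_f} ∩ D` has the same closure as `M`, so it competes in the same Zorn family.
    set N := (s.fin.idealCl M).comap (Algebra.linearMap D K)
    have hMN : M ≤ N := fun d hd =>
      s.fin.le_cl _ (coeSubmodule_ne_bot hM.prop.1) (algebraMap_mem_coeSubmodule.2 hd)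
    have hN : N ≠ ⊥ := fun h => hM.prop.1 (le_bot_iff.1 (h ▸ hMN))
    refine hM.le_of_ge ⟨hN, fun h => hM.prop.2 ?_⟩ hMN hd
    refine s.cl_le_cl_of_le (coeSubmodule_ne_bot hN) (coeSubmodule_ne_bot hM.prop.1) ?_ h
    intro x hx
    obtain ⟨d, hd, rfl⟩ := (IsLocalization.mem_coeSubmodule _ _).1 hx
    exact hd
  refine ⟨M, ⟨⟨fun h => ?_, hq⟩, ?_⟩, hIM⟩
  · refine hM.prop.2 (s.fin.le_cl _ (coeSubmodule_ne_bot hM.prop.1) ?_)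
    rw [← map_one (algebraMap D K), algebraMap_mem_coeSubmodule, h]
    trivial
  · rintro J ⟨hJ, hJq⟩ hMJ
    refine hM.le_of_ge ⟨hJq.1, fun h => hJ ?_⟩ hMJ
    rw [Ideal.eq_top_iff_one]
    exact hJq.mem (by rwa [map_one])

theorem IsQuasiMaximal.one_notMem {M : Ideal D} (hM : s.fin.IsQuasiMaximal M) :
    (1 : K) ∉ s.fin.idealCl M := fun h =>
  hM.prop.1 ((Ideal.eq_top_iff_one _).2 (hM.prop.2.mem (by rwa [map_one])))

theorem IsQuasiIdeal.exists_isQuasiMaximal_ge {I : Ideal D} (hI : s.fin.IsQuasiIdeal I)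
    (h : I ≠ ⊤) : ∃ M, s.fin.IsQuasiMaximal M ∧ I ≤ M :=
  SemistarOperation.exists_isQuasiMaximal_ge hI.1 fun h1 =>
    h ((Ideal.eq_top_iff_one _).2 (hI.mem (by rwa [map_one])))

theorem IsQuasiMaximal.isPrime {M : Ideal D} (hM : s.fin.IsQuasiMaximal M) : M.IsPrime := by
  refine ⟨hM.prop.1, fun {x y} hxy => or_iff_not_imp_left.2 fun hx => ?_⟩
  have hne : M ⊔ Ideal.span {x} ≠ ⊥ := fun h => hM.prop.2.1 (le_bot_iff.1 (h ▸ le_sup_left))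
  -- By maximality the closure of `M + xD` contains `1`, while `y(M + xD) ⊆ M`; multiplying by `y`
  -- gives `y ∈ M^{⋆_f} ∩ D = M`.
  have h1 : (1 : K) ∈ s.fin.idealCl (M ⊔ Ideal.span {x}) := by
    by_contra h1
    obtain ⟨N, hN, hle⟩ := SemistarOperation.exists_isQuasiMaximal_ge hne h1
    have := hM.le_of_ge hN.prop (le_sup_left.trans hle)
    exact hx (this (hle (Ideal.mem_sup_right (Ideal.mem_span_singleton_self x))))
  refine hM.prop.2.mem ?_
  rw [← mul_one (algebraMap D K y)]
  refine s.mul_mem_cl (coeSubmodule_ne_bot hne) (coeSubmodule_ne_bot hM.prop.2.1) ?_ h1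
  intro z hz
  obtain ⟨w, hw, rfl⟩ := (Submodule.mem_smul_pointwise_iff_exists _ _ _).1 hz
  obtain ⟨d, hd, rfl⟩ := (IsLocalization.mem_coeSubmodule _ _).1 hw
  refine s.fin.le_cl _ (coeSubmodule_ne_bot hM.prop.2.1) ?_
  rw [smul_eq_mul, ← map_mul, algebraMap_mem_coeSubmodule]
  obtain ⟨m, hm, n, hn, rfl⟩ := Submodule.mem_sup.1 hd
  obtain ⟨c, rfl⟩ := Ideal.mem_span_singleton'.1 hn
  rw [mul_add]
  refine add_mem (M.mul_mem_left _ hm) ?_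
  rw [show y * (c * x) = c * (x * y) by ring]
  exact M.mul_mem_left _ hxy

/-- The integral submodules `A` with `A^⋆ = D^⋆` are those contained in no quasi-maximal ideal. -/
theorem one_mem_cl_iff {A : Submodule D K} (hA : A ≤ 1) (h0 : A ≠ ⊥) :
    (1 : K) ∈ s.fin.cl A ↔
      ∀ M, s.fin.IsQuasiMaximal M → ∃ t ∉ M, algebraMap D K t ∈ A := by
  set J := A.comap (Algebra.linearMap D K) with hJ
  have hJA : coeSubmodule K J = A := coeSubmodule_comap hA
  have hJ0 : J ≠ ⊥ := fun h => h0 (by rw [← hJA, h, IsLocalization.coeSubmodule_bot])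
  constructor
  · intro h1 M hM
    by_contra! hcon
    refine hM.one_notMem (s.fin.cl_mono A _ h0 (coeSubmodule_ne_bot hM.prop.2.1) ?_ h1)
    rw [← hJA]
    refine IsLocalization.coeSubmodule_mono K fun t ht => ?_
    by_contra htM
    exact hcon t htM ht
  · intro h
    by_contra h1
    obtain ⟨M, hM, hJM⟩ := SemistarOperation.exists_isQuasiMaximal_ge (s := s) hJ0
      (by rwa [idealCl, hJA])
    obtain ⟨t, ht, htA⟩ := h M hM
    exact ht (hJM htA)

end QuasiMaximal

/-! ### Local description of `⋆_f` in a P⋆MD -/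

section Prufer

variable {s : SemistarOperation D K}

theorem IsPruferMultiplicationDomain.exists_mem_mul_inv (hD : s.IsPruferMultiplicationDomain)
    {F : Submodule D K} (hF : F.FG) (hF0 : F ≠ ⊥) {M : Ideal D} (hM : s.fin.IsQuasiMaximal M) :
    ∃ t ∉ M, algebraMap D K t ∈ F * (1 / F) := by
  have h1 : (1 : K) ∈ s.fin.cl (F * (1 / F)) := by
    rw [hD F hF hF0]
    exact s.fin.le_cl 1 one_ne_zero (Submodule.one_le.1 le_rfl)
  refine (one_mem_cl_iff Submodule.mul_one_div_le_one fun h => ?_).1 h1 M hM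
  rw [h, fin_cl_bot] at h1
  exact one_ne_zero h1

/-- For `F = D + Dx ⊆ D^⋆`, the inverse `1 / F` is an integral ideal of denominators of `x`. Since
`F(1 / F) ⊆ (1 / F)^{⋆_f}`, its closure contains `1`, so it has an element outside `M`. -/
theorem IsPruferMultiplicationDomain.cl_one_le (hD : s.IsPruferMultiplicationDomain) {x : K}
    (hx : x ∈ s.fin.cl 1) {M : Ideal D} (hM : s.fin.IsQuasiMaximal M) :
    ∃ t ∉ M, t • x ∈ (1 : Submodule D K) := by
  set F : Submodule D K := Submodule.span D {1, x}
  have h1F : (1 : K) ∈ F := Submodule.subset_span (by simp)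
  have hxF : x ∈ F := Submodule.subset_span (by simp)
  have hF : F.FG := Submodule.fg_span (Set.toFinite _)
  have hF0 : F ≠ ⊥ := fun h => one_ne_zero (α := K) (by rwa [h] at h1F)
  have hFD : F ≤ s.fin.cl 1 := by
    refine Submodule.span_le.2 ?_
    rintro y (rfl | rfl)
    · exact s.fin.le_cl 1 one_ne_zero (Submodule.one_le.1 le_rfl)
    · exact hx
  have h1 : (1 : K) ∈ s.fin.cl (F * (1 / F)) := by
    rw [hD F hF hF0]
    exact s.fin.le_cl 1 one_ne_zero (Submodule.one_le.1 le_rfl)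
  have hFG : F * (1 / F) ≠ ⊥ := fun h => by
    rw [h, fin_cl_bot] at h1
    exact one_ne_zero h1
  have hG : 1 / F ≠ ⊥ := fun h => hFG (by rw [h, Submodule.mul_bot])
  have hG1 : 1 / F ≤ 1 := fun g hg => by
    simpa using Submodule.mem_div_iff_forall_mul_mem.1 hg 1 h1F
  have h1G : (1 : K) ∈ s.fin.cl (1 / F) := by
    refine s.cl_le_cl_of_le hFG hG (Submodule.mul_le.2 fun f hf g hg => ?_) h1
    rw [mul_comm]
    refine s.mul_mem_cl one_ne_zero hG ?_ (hFD hf)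
    intro y hy
    obtain ⟨w, hw, rfl⟩ := (Submodule.mem_smul_pointwise_iff_exists _ _ _).1 hy
    obtain ⟨d, rfl⟩ := Submodule.mem_one.1 hw
    refine s.fin.le_cl _ hG ?_
    rw [smul_eq_mul, mul_comm, ← Algebra.smul_def]
    exact Submodule.smul_mem _ _ hg
  obtain ⟨t, ht, htG⟩ := (one_mem_cl_iff hG1 hG).1 h1G M hM
  refine ⟨t, ht, ?_⟩
  rw [Algebra.smul_def]
  exact Submodule.mem_div_iff_forall_mul_mem.1 htG x hxF

/-- In a Prüfer `⋆`-multiplication domain, `E^{⋆_f}` is the intersection of the localizations of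
`E` at the quasi-`⋆_f`-maximal ideals. -/
theorem IsPruferMultiplicationDomain.mem_cl_iff (hD : s.IsPruferMultiplicationDomain)
    {E : Submodule D K} (hE : E ≠ ⊥) {x : K} :
    x ∈ s.fin.cl E ↔ ∀ M, s.fin.IsQuasiMaximal M → ∃ t ∉ M, t • x ∈ E := by
  constructor
  · intro hx M hM
    have := hM.isPrime
    obtain ⟨F, hF, hF0, hFE, hxF⟩ := (s.mem_finCl hE x).1 hx
    obtain ⟨u, hu, huF⟩ := hD.exists_mem_mul_inv hF hF0 hM
    -- If `gF ⊆ D`, then `xg ∈ D^⋆ ⊆ D_M`, hence `x(fg) ∈ E D_M`. Apply this to `u ∈ F(1 / F)`, a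
    -- unit of `D_M`.
    have key : ∀ v ∈ F * (1 / F), x * v ∈ E * localRing K M := by
      intro v hv
      induction hv using Submodule.mul_induction_on' with
      | mem_mul_mem f hf g hg =>
        rw [mul_left_comm]
        refine Submodule.mul_mem_mul (hFE hf) (hD.cl_one_le ?_ hM)
        rw [mul_comm]
        have hxF' : x ∈ s.fin.cl F := (s.mem_finCl hF0 x).2 ⟨F, hF, hF0, le_rfl, hxF⟩
        refine s.mul_mem_cl hF0 one_ne_zero ?_ hxF'
        intro y hy
        obtain ⟨w, hw, rfl⟩ := (Submodule.mem_smul_pointwise_iff_exists _ _ _).1 hy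
        exact s.fin.le_cl 1 one_ne_zero (Submodule.mem_div_iff_forall_mul_mem.1 hg w hw)
      | add y _ z _ hy hz =>
        rw [mul_add]
        exact add_mem hy hz
    obtain ⟨t, ht, htE⟩ := mem_mul_localRing.1 (key _ huF)
    refine ⟨t * u, fun h => (this.mem_or_mem h).elim ht hu, ?_⟩
    rwa [mul_smul, Algebra.smul_def u, mul_comm]
  · intro h
    -- The conductor `(E :_D x)` lies in no quasi-maximal ideal, so `1 ∈ J^{⋆_f}`; multiply by `x`,
    -- using `xJ ⊆ E`.
    set J : Ideal D := E.comap (LinearMap.toSpanSingleton D K x)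
    have hJ : ∀ d, d ∈ J ↔ d • x ∈ E := fun d => Iff.rfl
    have hJ0 : J ≠ ⊥ := by
      obtain ⟨e, he, he0⟩ := Submodule.exists_mem_ne_zero_of_ne_bot hE
      obtain ⟨p, q, hq, hpq⟩ := IsFractionRing.div_surjective (A := D) e
      obtain ⟨a, b, hb, hab⟩ := IsFractionRing.div_surjective (A := D) x
      have hq0 : algebraMap D K q ≠ 0 := IsFractionRing.to_map_ne_zero_of_mem_nonZeroDivisors hq
      have hb0 : algebraMap D K b ≠ 0 := IsFractionRing.to_map_ne_zero_of_mem_nonZeroDivisors hb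
      have hp0 : p ≠ 0 := fun h => he0 (by rw [← hpq, h, map_zero, zero_div])
      have hmem : p * b ∈ J := by
        rw [hJ]
        have : (p * b) • x = (a * q) • e := by
          rw [Algebra.smul_def, Algebra.smul_def, map_mul, map_mul, ← hpq, ← hab]
          field_simp
        rw [this]
        exact Submodule.smul_mem _ _ he
      intro h
      rw [h, Submodule.mem_bot] at hmem
      exact mul_ne_zero hp0 (nonZeroDivisors.ne_zero hb) hmem
    have hJ1 : coeSubmodule K J ≤ 1 := by
      rw [← IsLocalization.coeSubmodule_top]
      exact IsLocalization.coeSubmodule_mono K le_top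
    have h1 : (1 : K) ∈ s.fin.cl (coeSubmodule K J) := by
      refine (one_mem_cl_iff hJ1 (coeSubmodule_ne_bot hJ0)).2 fun M hM => ?_
      obtain ⟨t, ht, htx⟩ := h M hM
      exact ⟨t, ht, algebraMap_mem_coeSubmodule.2 htx⟩
    rw [← mul_one x]
    refine s.mul_mem_cl (coeSubmodule_ne_bot hJ0) hE ?_ h1
    intro y hy
    obtain ⟨w, hw, rfl⟩ := (Submodule.mem_smul_pointwise_iff_exists _ _ _).1 hy
    obtain ⟨d, hd, rfl⟩ := (IsLocalization.mem_coeSubmodule _ _).1 hw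
    refine s.fin.le_cl E hE ?_
    rw [smul_eq_mul, mul_comm, ← Algebra.smul_def]
    exact hd

theorem idealCl_le_idealCl_iff {I J : Ideal D} (hI : I ≠ ⊥) (hJ : J ≠ ⊥) :
    s.fin.idealCl I ≤ s.fin.idealCl J ↔ ∀ d ∈ I, algebraMap D K d ∈ s.fin.idealCl J := by
  constructor
  · intro h d hd
    exact h (s.fin.le_cl _ (coeSubmodule_ne_bot hI) (algebraMap_mem_coeSubmodule.2 hd))
  · intro h
    refine s.cl_le_cl_of_le (coeSubmodule_ne_bot hI) (coeSubmodule_ne_bot hJ) fun x hx => ?_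
    obtain ⟨d, hd, rfl⟩ := (IsLocalization.mem_coeSubmodule _ _).1 hx
    exact h d hd

theorem IsQuasiIdeal.le_of_idealCl_le {I J : Ideal D} (hJ : s.fin.IsQuasiIdeal J) (hI : I ≠ ⊥)
    (h : s.fin.idealCl I ≤ s.fin.idealCl J) : I ≤ J := fun d hd =>
  hJ.mem ((idealCl_le_idealCl_iff hI hJ.1).1 h d hd)

theorem idealCl_mono {I J : Ideal D} (hI : I ≠ ⊥) (h : I ≤ J) :
    s.fin.idealCl I ≤ s.fin.idealCl J :=
  s.fin.cl_mono _ _ (coeSubmodule_ne_bot hI)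
    (coeSubmodule_ne_bot fun hJ => hI (le_bot_iff.1 (hJ ▸ h))) (IsLocalization.coeSubmodule_mono K h)

/-! ### Valuation localizations and factorization of idempotent ideals -/

namespace IsPruferMultiplicationDomain

theorem algebraMap_mem_idealCl_iff (hD : s.IsPruferMultiplicationDomain)
    {I : Ideal D} (hI : I ≠ ⊥) {d : D} :
    algebraMap D K d ∈ s.fin.idealCl I ↔
      ∀ M, s.fin.IsQuasiMaximal M → ∃ t ∉ M, t * d ∈ I := by
  rw [idealCl, hD.mem_cl_iff (coeSubmodule_ne_bot hI)]
  simp only [Algebra.smul_def, ← map_mul, algebraMap_mem_coeSubmodule]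

theorem idealCl_eq_iff (hD : s.IsPruferMultiplicationDomain)
    {I J : Ideal D} (hI : I ≠ ⊥) (hJ : J ≠ ⊥) :
    s.fin.idealCl I = s.fin.idealCl J ↔
      ∀ (M : Ideal D) [M.IsPrime], s.fin.IsQuasiMaximal M → idealLoc K M I = idealLoc K M J := by
  simp only [le_antisymm_iff (α := Submodule D K), idealLoc_le_iff, idealCl_le_idealCl_iff hI hJ,
    idealCl_le_idealCl_iff hJ hI, hD.algebraMap_mem_idealCl_iff hI,
    hD.algebraMap_mem_idealCl_iff hJ]
  constructor
  · rintro ⟨h₁, h₂⟩ M _ hM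
    exact ⟨fun d hd => h₁ d hd M hM, fun d hd => h₂ d hd M hM⟩
  · intro h
    exact ⟨fun d hd M hM => (@h M hM.isPrime hM).1 d hd,
      fun d hd M hM => (@h M hM.isPrime hM).2 d hd⟩

theorem isIdempotentIdeal_iff (hD : s.IsPruferMultiplicationDomain) {I : Ideal D} (hI : I ≠ ⊥) :
    s.fin.IsIdempotentIdeal I ↔ ∀ (M : Ideal D) [M.IsPrime], s.fin.IsQuasiMaximal M →
      idealLoc K M I * idealLoc K M I = idealLoc K M I := by
  rw [IsIdempotentIdeal, hD.idealCl_eq_iff hI (pow_ne_zero 2 hI)]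
  simp only [sq, idealLoc_mul]
  exact ⟨fun h M _ hM => (h M hM).symm, fun h M _ hM => (h M hM).symm⟩

/-- A prime ideal contained in a quasi-maximal ideal is a quasi-ideal. -/
theorem isQuasiIdeal_of_isPrime (hD : s.IsPruferMultiplicationDomain)
    {P M : Ideal D} (hP : P.IsPrime) (hP0 : P ≠ ⊥)
    (hM : s.fin.IsQuasiMaximal M) (hPM : P ≤ M) : s.fin.IsQuasiIdeal P := by
  refine s.isQuasiIdeal_of_le hP0 fun d hd => ?_
  obtain ⟨t, ht, htd⟩ := (hD.algebraMap_mem_idealCl_iff hP0).1 hd M hM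
  exact (hP.mem_or_mem htd).resolve_left fun h => ht (hPM h)

/-- The localization at a quasi-maximal ideal is a valuation ring. -/
theorem exists_dvd_or_dvd (hD : s.IsPruferMultiplicationDomain)
    {M : Ideal D} (hM : s.fin.IsQuasiMaximal M) (a b : D) :
    ∃ t ∉ M, a ∣ t * b ∨ b ∣ t * a := by
  have hMp := hM.isPrime
  by_cases ha : a = 0
  · exact ⟨1, fun h => hMp.ne_top ((Ideal.eq_top_iff_one _).2 h), Or.inr (by simp [ha])⟩
  have hinj := IsFractionRing.injective D K
  set A := algebraMap D K a
  set B := algebraMap D K b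
  have hF0 : Submodule.span D {A, B} ≠ ⊥ := fun h => ha <| by
    have : A ∈ Submodule.span D {A, B} := Submodule.subset_span (by simp)
    rw [h, Submodule.mem_bot] at this
    exact hinj (this.trans (map_zero _).symm)
  obtain ⟨t, ht, htF⟩ := hD.exists_mem_mul_inv (Submodule.fg_span (Set.toFinite {A, B})) hF0 hM
  rw [Submodule.span_insert, Submodule.sup_mul, Submodule.mem_sup] at htF
  obtain ⟨y, hy, z, hz, hyz⟩ := htF
  obtain ⟨p, hp, rfl⟩ := Submodule.mem_span_singleton_mul.1 hy
  obtain ⟨q, hq, rfl⟩ := Submodule.mem_span_singleton_mul.1 hz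
  rw [← Submodule.span_insert, Submodule.mem_div_iff_forall_mul_mem] at hp hq
  have hA : A ∈ Submodule.span D {A, B} := Submodule.subset_span (by simp)
  have hB : B ∈ Submodule.span D {A, B} := Submodule.subset_span (by simp)
  obtain ⟨pa, hpa⟩ := Submodule.mem_one.1 (hp A hA)
  obtain ⟨pb, hpb⟩ := Submodule.mem_one.1 (hp B hB)
  obtain ⟨qa, hqa⟩ := Submodule.mem_one.1 (hq A hA)
  obtain ⟨qb, hqb⟩ := Submodule.mem_one.1 (hq B hB)
  -- All four products are in `D`, and `pa`, `qb` cannot both lie in `M`. The cross relations `pa·b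
  -- = pb·a` and `qb·a = qa·b` then give the divisibility.
  have htm : t = pa + qb := hinj (by rw [map_add, hpa, hqb, ← hyz]; ring)
  by_cases hpaM : pa ∈ M
  · refine ⟨qb, fun h => ht (htm ▸ add_mem hpaM h), Or.inr ⟨qa, hinj ?_⟩⟩
    rw [map_mul, map_mul, hqb, hqa]; ring
  · refine ⟨pa, hpaM, Or.inl ⟨pb, hinj ?_⟩⟩
    rw [map_mul, map_mul, hpa, hpb]; ring

theorem exists_dvd_of_mem_of_notMem (hD : s.IsPruferMultiplicationDomain)
    {M P : Ideal D} (hM : s.fin.IsQuasiMaximal M)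
    (hP : P.IsPrime) (hPM : P ≤ M) {w p : D} (hw : w ∉ P) (hp : p ∈ P) :
    ∃ t ∉ M, w ∣ t * p := by
  obtain ⟨t, ht, h | ⟨c, hc⟩⟩ := hD.exists_dvd_or_dvd hM w p
  · exact ⟨t, ht, h⟩
  · have : t * w ∈ P := hc ▸ P.mul_mem_right _ hp
    exact ((hP.mem_or_mem this).elim (fun h => ht (hPM h)) hw).elim

/-- A locally idempotent ideal is locally prime. -/
theorem exists_isPrime_localization (hD : s.IsPruferMultiplicationDomain)
    {M I : Ideal D} (hM : s.fin.IsQuasiMaximal M) (hIM : I ≤ M)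
    (hI0 : I ≠ ⊥) (hI : s.fin.IsIdempotentIdeal I) :
    ∃ P : Ideal D, P.IsPrime ∧ I ≤ P ∧ P ≤ M ∧ ∀ d, d ∈ P ↔ ∃ t ∉ M, t * d ∈ I := by
  have hMp := hM.isPrime
  have h1M : (1 : D) ∉ M := fun h => hMp.ne_top ((Ideal.eq_top_iff_one _).2 h)
  set P : Ideal D := (idealLoc K M I).comap (Algebra.linearMap D K)
  have hP : ∀ d, d ∈ P ↔ ∃ t ∉ M, t * d ∈ I := fun d => algebraMap_mem_idealLoc
  have hPM : P ≤ M := fun d hd => by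
    obtain ⟨t, ht, htd⟩ := (hP d).1 hd
    exact (hMp.mem_or_mem (hIM htd)).resolve_left ht
  refine ⟨P, ⟨fun h => h1M (hPM (h ▸ Submodule.mem_top)), fun {x y} hxy =>
    or_iff_not_imp_left.2 fun hx => ?_⟩, fun d hd => (hP d).2 ⟨1, h1M, by rwa [one_mul]⟩, hPM, hP⟩
  -- Since `x ∉ I D_M`, the valuation property gives `I D_M ⊆ x D_M`. Hence `xy ∈ I D_M = I² D_M ⊆ x
  -- I D_M`, and cancelling `x` leaves `y ∈ I D_M`.
  have hdvd : ∀ i ∈ I, ∃ t ∉ M, x ∣ t * i := by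
    intro i hi
    obtain ⟨t, ht, h | ⟨c, hc⟩⟩ := hD.exists_dvd_or_dvd hM x i
    · exact ⟨t, ht, h⟩
    · exact (hx ((hP x).2 ⟨t, ht, hc ▸ I.mul_mem_right _ hi⟩)).elim
  have hprod : ∀ z ∈ I * I, ∃ t ∉ M, ∃ i ∈ I, t * z = x * i := by
    intro z hz
    induction hz using Submodule.mul_induction_on' with
    | mem_mul_mem i hi j hj =>
      obtain ⟨t, ht, c, hc⟩ := hdvd i hi
      exact ⟨t, ht, c * j, I.mul_mem_left _ hj, by rw [← mul_assoc, hc, mul_assoc]⟩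
    | add y _ z _ hy hz =>
      obtain ⟨t, ht, i, hi, hti⟩ := hy
      obtain ⟨u, hu, j, hj, huj⟩ := hz
      refine ⟨t * u, fun h => (hMp.mem_or_mem h).elim ht hu, u * i + t * j,
        add_mem (I.mul_mem_left _ hi) (I.mul_mem_left _ hj), ?_⟩
      linear_combination u * hti + t * huj
  have hxy' : algebraMap D K (x * y) ∈ idealLoc K M (I * I) := by
    rw [idealLoc_mul, (hD.isIdempotentIdeal_iff hI0).1 hI M hM]
    exact hxy
  obtain ⟨t, ht, htxy⟩ := algebraMap_mem_idealLoc.1 hxy'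
  obtain ⟨u, hu, i, hi, hui⟩ := hprod _ htxy
  have hx0 : x ≠ 0 := fun h => hx (h ▸ P.zero_mem)
  refine (hP y).2 ⟨u * t, fun h => (hMp.mem_or_mem h).elim hu ht, ?_⟩
  have : u * t * y = i := mul_left_cancel₀ hx0 (by linear_combination hui)
  rwa [this]

/-- An idempotent quasi-ideal is a product of pairwise incomparable idempotent quasi-primes, which
are its localizations at the quasi-maximal ideals that contain it. -/
theorem exists_finset_prod (hD : s.IsPruferMultiplicationDomain)
    (hfin : s.fin.HasFiniteCharacter) {I : Ideal D}
    (hI0 : I ≠ ⊥) (hI : s.fin.IsIdempotentIdeal I) :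
    ∃ S : Finset (Ideal D), (∀ P ∈ S, s.fin.IsQuasiPrime P ∧ s.fin.IsIdempotentIdeal P) ∧
      IsAntichain (· ≤ ·) (S : Set (Ideal D)) ∧ s.fin.idealCl I = s.fin.idealCl (∏ P ∈ S, P) ∧
      ∀ M, s.fin.IsQuasiMaximal M → I ≤ M →
        ∃ P ∈ S, I ≤ P ∧ P ≤ M ∧ ∀ d ∈ P, ∃ t ∉ M, t * d ∈ I := by
  classical
  obtain ⟨i, hi, hi0⟩ := Submodule.exists_mem_ne_zero_of_ne_bot hI0
  have hT : {M : Ideal D | s.fin.IsQuasiMaximal M ∧ I ≤ M}.Finite :=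
    (hfin i hi0).subset fun M hM => ⟨hM.1, hM.2 hi⟩
  have hex : ∀ M : Ideal D, s.fin.IsQuasiMaximal M ∧ I ≤ M →
      ∃ P : Ideal D, P.IsPrime ∧ I ≤ P ∧ P ≤ M ∧ ∀ d, d ∈ P ↔ ∃ t ∉ M, t * d ∈ I :=
    fun M hM => hD.exists_isPrime_localization hM.1 hM.2 hI0 hI
  choose! p hprime hIp hpM hmem using hex
  -- If `td ∈ I ⊆ p M` with `t ∉ N ⊇ p M`, primality forces `d ∈ p M`. Applying this twice makes `p
  -- M` and `p N` equal.
  have hhalf : ∀ M N, s.fin.IsQuasiMaximal M ∧ I ≤ M → s.fin.IsQuasiMaximal N ∧ I ≤ N →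
      p M ≤ N → p N ≤ p M := by
    intro M N hM hN hMN d hd
    obtain ⟨t, ht, htd⟩ := (hmem N hN d).1 hd
    exact ((hprime M hM).mem_or_mem (hIp M hM htd)).resolve_left fun h => ht (hMN h)
  have heq : ∀ M N, s.fin.IsQuasiMaximal M ∧ I ≤ M → s.fin.IsQuasiMaximal N ∧ I ≤ N →
      p M ≤ N → p M = p N := fun M N hM hN h =>
    have h' := hhalf M N hM hN h
    le_antisymm (hhalf N M hN hM (h'.trans (hpM M hM))) h'
  have hloc : ∀ (M : Ideal D) [M.IsPrime], s.fin.IsQuasiMaximal M ∧ I ≤ M →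
      idealLoc K M I = idealLoc K M (p M) := fun M _ hM =>
    le_antisymm (idealLoc_mono (hIp M hM))
      (idealLoc_le_iff.2 fun d hd => (hmem M hM d).1 hd)
  have hp0 : ∀ M, s.fin.IsQuasiMaximal M ∧ I ≤ M → p M ≠ ⊥ := fun M hM h =>
    hI0 (le_bot_iff.1 (h ▸ hIp M hM))
  have hS : ∀ {P}, P ∈ hT.toFinset.image p ↔ ∃ M, (s.fin.IsQuasiMaximal M ∧ I ≤ M) ∧ p M = P := by
    intro P
    simp only [Finset.mem_image, Set.Finite.mem_toFinset, Set.mem_ofPred_eq]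
  have hS0 : ∀ P ∈ hT.toFinset.image p, P ≠ ⊥ := fun P hP => by
    obtain ⟨M, hM, rfl⟩ := hS.1 hP
    exact hp0 M hM
  refine ⟨hT.toFinset.image p, fun P hP => ?_, ?_, ?_, fun M hM hIM => ?_⟩
  · obtain ⟨M, hM, rfl⟩ := hS.1 hP
    refine ⟨⟨hprime M hM, hD.isQuasiIdeal_of_isPrime (hprime M hM) (hp0 M hM) hM.1 (hpM M hM)⟩,
      (hD.isIdempotentIdeal_iff (hp0 M hM)).2 fun N _ hN => ?_⟩
    by_cases hMN : p M ≤ N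
    · have hN' : s.fin.IsQuasiMaximal N ∧ I ≤ N := ⟨hN, (hIp M hM).trans hMN⟩
      rw [heq M N hM hN' hMN, ← hloc N hN', (hD.isIdempotentIdeal_iff hI0).1 hI N hN]
    · rw [idealLoc_of_not_le hMN, localRing_mul_self]
  · intro P hP Q hQ hPQ hle
    obtain ⟨M, hM, rfl⟩ := hS.1 hP
    obtain ⟨N, hN, rfl⟩ := hS.1 hQ
    exact hPQ (heq M N hM hN (hle.trans (hpM N hN)))
  · refine (hD.idealCl_eq_iff hI0 (Finset.prod_ne_zero_iff.2 hS0)).2 fun M hMp hM => ?_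
    by_cases hIM : I ≤ M
    · rw [idealLoc_prod_eq (hS.2 ⟨M, ⟨hM, hIM⟩, rfl⟩), hloc M ⟨hM, hIM⟩]
      intro Q hQ hQM
      obtain ⟨N, hN, rfl⟩ := hS.1 hQ
      exact heq N M hN ⟨hM, hIM⟩ hQM
    · rw [idealLoc_of_not_le hIM, idealLoc_of_not_le]
      intro hle
      obtain ⟨Q, hQ, hQM⟩ := hMp.prod_le.1 hle
      obtain ⟨N, hN, rfl⟩ := hS.1 hQ
      exact hIM ((hIp N hN).trans hQM)
  · exact ⟨p M, hS.2 ⟨M, ⟨hM, hIM⟩, rfl⟩, hIp M ⟨hM, hIM⟩, hpM M ⟨hM, hIM⟩,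
      fun d hd => (hmem M ⟨hM, hIM⟩ d).1 hd⟩

theorem isIdempotentIdeal_of_isStarProductOf (hD : s.IsPruferMultiplicationDomain)
    {C : Ideal D → Prop} {I : Ideal D} (hI0 : I ≠ ⊥)
    (hC : ∀ P, C P → P ≠ ⊥ ∧ s.fin.IsIdempotentIdeal P) (h : s.fin.IsStarProductOf C I) :
    s.fin.IsIdempotentIdeal I := by
  obtain ⟨n, P, hP, hIP⟩ := h
  have h0 : ∏ i, P i ≠ ⊥ := Finset.prod_ne_zero_iff.2 fun i _ => (hC _ (hP i)).1
  refine (hD.isIdempotentIdeal_iff hI0).2 fun M _ hM => ?_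
  rw [(hD.idealCl_eq_iff hI0 h0).1 hIP M hM]
  refine Finset.prod_induction P
    (fun J => idealLoc K M J * idealLoc K M J = idealLoc K M J) ?_ ?_ fun i _ =>
      (hD.isIdempotentIdeal_iff (hC _ (hP i)).1).1 (hC _ (hP i)).2 M hM
  · intro J J' hJ hJ'
    rw [idealLoc_mul, mul_mul_mul_comm, hJ, hJ']
  · rw [Ideal.one_eq_top, idealLoc_top, localRing_mul_self]

end IsPruferMultiplicationDomain

theorem isStarProductOf_finset {C : Ideal D → Prop} {I : Ideal D} {S : Finset (Ideal D)}
    (hS : ∀ P ∈ S, C P) (h : s.idealCl I = s.idealCl (∏ P ∈ S, P)) : s.IsStarProductOf C I := by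
  refine ⟨S.card, fun i => (S.equivFin.symm i : Ideal D), fun i => hS _ (S.equivFin.symm i).2, ?_⟩
  rw [h, Equiv.prod_comp S.equivFin.symm (fun P : S => (P : Ideal D)),
    Finset.prod_coe_sort S (fun P => P)]

/-- The factors of a product of pairwise incomparable quasi-primes are the minimal primes. -/
theorem IsQuasiIdeal.mem_minimalPrimes_iff {I : Ideal D} (hI : s.fin.IsQuasiIdeal I)
    {S : Finset (Ideal D)} (hS : ∀ P ∈ S, s.fin.IsQuasiPrime P)
    (hanti : IsAntichain (· ≤ ·) (S : Set (Ideal D)))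
    (h : s.fin.idealCl I = s.fin.idealCl (∏ P ∈ S, P)) (P : Ideal D) :
    P ∈ I.minimalPrimes ↔ P ∈ S := by
  have h0 : ∏ P ∈ S, P ≠ ⊥ := Finset.prod_ne_zero_iff.2 fun P hP => (hS P hP).2.1
  have hle : ∏ P ∈ S, P ≤ I := hI.le_of_idealCl_le h0 h.ge
  have hIS : ∀ Q ∈ S, I ≤ Q := fun Q hQ =>
    (hS Q hQ).2.le_of_idealCl_le hI.1
      (h.le.trans (idealCl_mono h0 (Ideal.prod_le_inf.trans (Finset.inf_le hQ))))
  constructor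
  · intro hP
    obtain ⟨Q, hQ, hQP⟩ := hP.1.1.prod_le.1 (hle.trans hP.1.2)
    rwa [le_antisymm (hP.2 ⟨(hS Q hQ).1, hIS Q hQ⟩ hQP) hQP]
  · intro hP
    refine ⟨⟨(hS P hP).1, hIS P hP⟩, fun Q hQ hQP => ?_⟩
    obtain ⟨R, hR, hRQ⟩ := hQ.1.prod_le.1 (hle.trans hQ.2)
    have : R = P := by
      by_contra hne
      exact hanti hR hP hne (hRQ.trans hQP)
    exact this ▸ hRQ

/-- If an ideal is a product of primes satisfying `C`, its incomparable factors satisfy `C`. -/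
theorem IsPruferMultiplicationDomain.forall_mem_of_isStarProductOf
    (hD : s.IsPruferMultiplicationDomain) {I : Ideal D} (hI : s.fin.IsQuasiIdeal I)
    {S : Finset (Ideal D)} (hS : ∀ P ∈ S, s.fin.IsQuasiPrime P)
    (hanti : IsAntichain (· ≤ ·) (S : Set (Ideal D)))
    (h : s.fin.idealCl I = s.fin.idealCl (∏ P ∈ S, P)) {C : Ideal D → Prop}
    (hC : ∀ P, C P → P.IsPrime ∧ P ≠ ⊥) (hIC : s.fin.IsStarProductOf C I) : ∀ P ∈ S, C P := by
  obtain ⟨n, Q, hQ, hIQ⟩ := hIC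
  intro P hP
  have hmin := (hI.mem_minimalPrimes_iff hS hanti h P).2 hP
  have h0 : ∏ i, Q i ≠ ⊥ := Finset.prod_ne_zero_iff.2 fun i _ => (hC _ (hQ i)).2
  obtain ⟨i, -, hi⟩ := hmin.1.1.prod_le.1 ((hI.le_of_idealCl_le h0 hIQ.ge).trans hmin.1.2)
  -- `C` need not include being a quasi-ideal, but `Q i ≤ P ≤ M` supplies it. Then `I ≤ Q i`, and
  -- minimality of `P` over `I` gives `Q i = P`.
  obtain ⟨M, hM, hPM⟩ := (hS P hP).2.exists_isQuasiMaximal_ge (hS P hP).1.ne_top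
  have hq := hD.isQuasiIdeal_of_isPrime (hC _ (hQ i)).1 (hC _ (hQ i)).2 hM (hi.trans hPM)
  have hIi : I ≤ Q i := hq.le_of_idealCl_le hI.1 (hIQ.le.trans
    (idealCl_mono h0 (Ideal.prod_le_inf.trans (Finset.inf_le (Finset.mem_univ i)))))
  rw [le_antisymm (hmin.2 ⟨(hC _ (hQ i)).1, hIi⟩ hi) hi]
  exact hQ i

end Prufer

/-! ### Divisoriality of idempotent ideals -/

section Divisorial

variable {s : SemistarOperation D K}

theorem mem_cl_one_div_iff {I : Ideal D} (hI : I ≠ ⊥) {z : K} :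
    z ∈ s.cl 1 / s.fin.idealCl I ↔ ∀ d ∈ I, z * algebraMap D K d ∈ s.fin.cl 1 := by
  rw [Submodule.mem_div_iff_forall_mul_mem, ← fin_cl_one]
  constructor
  · intro h d hd
    exact h _ (s.fin.le_cl _ (coeSubmodule_ne_bot hI) (algebraMap_mem_coeSubmodule.2 hd))
  · intro h y hy
    refine s.mul_mem_cl (coeSubmodule_ne_bot hI) one_ne_zero (fun x hx => ?_) hy
    obtain ⟨w, hw, rfl⟩ := (Submodule.mem_smul_pointwise_iff_exists _ _ _).1 hx
    obtain ⟨d, hd, rfl⟩ := (IsLocalization.mem_coeSubmodule _ _).1 hw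
    exact h d hd

theorem isFinDivisorial_of_le {I : Ideal D}
    (h : s.cl 1 / (s.cl 1 / s.fin.idealCl I) ≤ s.fin.idealCl I) : s.IsFinDivisorial I := by
  refine le_antisymm h (Submodule.le_div_iff.2 fun x hx z hz => ?_)
  rw [mul_comm]
  exact Submodule.mem_div_iff_forall_mul_mem.1 hz x hx

theorem IsFinDivisorial.mem_idealCl {I : Ideal D} (h : s.IsFinDivisorial I) (hI : I ≠ ⊥) {x : K}
    (hx : ∀ z : K, (∀ d ∈ I, z * algebraMap D K d ∈ s.fin.cl 1) → x * z ∈ s.fin.cl 1) :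
    x ∈ s.fin.idealCl I := by
  rw [← h, Submodule.mem_div_iff_forall_mul_mem, ← fin_cl_one]
  intro z hz
  rw [fin_cl_one] at hz
  exact hx z ((mem_cl_one_div_iff hI).1 hz)

namespace IsPruferMultiplicationDomain

/-- The inverse of an idempotent quasi-maximal ideal is trivial. -/
theorem mem_cl_one_of_mul_mem (hD : s.IsPruferMultiplicationDomain)
    {M : Ideal D} (hM : s.fin.IsQuasiMaximal M)
    (hidem : s.fin.IsIdempotentIdeal M) {z : K}
    (hz : ∀ d ∈ M, z * algebraMap D K d ∈ s.fin.cl 1) : z ∈ s.fin.cl 1 := by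
  refine (hD.mem_cl_iff one_ne_zero).2 fun N hN => ?_
  have hNp := hN.isPrime
  by_cases hMN : M ≤ N
  · obtain rfl : M = N := le_antisymm hMN (hM.le_of_ge hN.prop hMN)
    obtain ⟨a, b, hb, rfl⟩ := IsFractionRing.div_surjective (A := D) z
    have hb0 : algebraMap D K b ≠ 0 := IsFractionRing.to_map_ne_zero_of_mem_nonZeroDivisors hb
    obtain ⟨t, ht, ⟨c, hc⟩ | ⟨c, hc⟩⟩ := hD.exists_dvd_or_dvd hM b a
    · refine ⟨t, ht, Submodule.mem_one.2 ⟨c, ?_⟩⟩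
      rw [Algebra.smul_def, mul_div_assoc', ← map_mul, hc, map_mul, mul_div_cancel_left₀ _ hb0]
    have hzc : algebraMap D K a / algebraMap D K b * algebraMap D K c = algebraMap D K t := by
      rw [div_mul_eq_mul_div, ← map_mul, ← hc, map_mul, mul_div_cancel_right₀ _ hb0]
    by_cases hcM : c ∈ M
    · exfalso
      set z := algebraMap D K a / algebraMap D K b
      -- Here `z = t / c` with `c ∈ M`. From `zM ⊆ D_M` follows `zM² ⊆ M D_M`; since `c ∈ M D_M = M²
      -- D_M`, this would put `zc = t` in `M`.
      have key : ∀ e ∈ M * M, z * algebraMap D K e ∈ idealLoc K M M := by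
        intro e he
        induction he using Submodule.mul_induction_on' with
        | mem_mul_mem m hm n hn =>
          rw [map_mul, ← mul_assoc, mul_comm]
          exact Submodule.mul_mem_mul (algebraMap_mem_coeSubmodule.2 hn)
            ((hD.mem_cl_iff one_ne_zero).1 (hz m hm) M hM)
        | add x _ y _ hx hy =>
          rw [map_add, mul_add]
          exact add_mem hx hy
      have hc' : algebraMap D K c ∈ idealLoc K M (M * M) := by
        rw [idealLoc_mul, (hD.isIdempotentIdeal_iff hM.prop.2.1).1 hidem M hM]
        exact algebraMap_mem_idealLoc_of_mem hcM
      obtain ⟨u, hu, huc⟩ := algebraMap_mem_idealLoc.1 hc'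
      have := key _ huc
      rw [map_mul, mul_left_comm, hzc, ← map_mul, algebraMap_mem_idealLoc_prime le_rfl] at this
      exact (hNp.mem_or_mem this).elim hu ht
    · refine ⟨c, hcM, Submodule.mem_one.2 ⟨t, ?_⟩⟩
      rw [Algebra.smul_def, mul_comm, hzc]
  · obtain ⟨m, hm, hmN⟩ := SetLike.not_le_iff_exists.1 hMN
    obtain ⟨t, ht, htz⟩ := (hD.mem_cl_iff one_ne_zero).1 (hz m hm) N hN
    refine ⟨t * m, fun h => (hNp.mem_or_mem h).elim ht hmN, ?_⟩
    rwa [mul_smul, Algebra.smul_def m, mul_comm (algebraMap D K m)]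

theorem not_isFinDivisorial_of_isQuasiMaximal (hD : s.IsPruferMultiplicationDomain)
    {M : Ideal D} (hM : s.fin.IsQuasiMaximal M)
    (hidem : s.fin.IsIdempotentIdeal M) : ¬ s.IsFinDivisorial M := fun h =>
  hM.one_notMem (h.mem_idealCl hM.prop.2.1 fun z hz => by
    rw [one_mul]
    exact hD.mem_cl_one_of_mul_mem hM hidem hz)

/-- An incomparable factor of a divisorial ideal is not an idempotent quasi-maximal ideal. -/
theorem not_isQuasiMaximal_of_isFinDivisorial (hD : s.IsPruferMultiplicationDomain)
    {I : Ideal D} (hI : s.fin.IsQuasiIdeal I)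
    (hdiv : s.IsFinDivisorial I) {S : Finset (Ideal D)} (hS : ∀ P ∈ S, s.fin.IsQuasiPrime P)
    (hanti : IsAntichain (· ≤ ·) (S : Set (Ideal D)))
    (h : s.fin.idealCl I = s.fin.idealCl (∏ P ∈ S, P)) {P : Ideal D} (hP : P ∈ S)
    (hidem : s.fin.IsIdempotentIdeal P) : ¬ s.fin.IsQuasiMaximal P := by
  classical
  intro hPM
  have hle : ∏ P ∈ S, P ≤ I :=
    hI.le_of_idealCl_le (Finset.prod_ne_zero_iff.2 fun P hP => (hS P hP).2.1) h.ge
  have hIP : I ≤ P := ((hI.mem_minimalPrimes_iff hS hanti h P).2 hP).1.2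
  -- Let `j` be in the product of the other factors. If `zI ⊆ D^⋆`, then `(jz)P ⊆ D^⋆`, so `jz ∈
  -- D^⋆` because `P` has trivial inverse. Divisoriality then puts `j` in `I`.
  have hJ : ∏ Q ∈ S.erase P, Q ≤ P := by
    refine le_trans (fun j hj => hI.mem ?_) hIP
    refine hdiv.mem_idealCl hI.1 fun z hz => hD.mem_cl_one_of_mul_mem hPM hidem fun m hm => ?_
    have : m * j ∈ I := hle (by
      rw [← Finset.mul_prod_erase S (fun Q => Q) hP]
      exact Ideal.mul_mem_mul hm hj)
    convert hz _ this using 1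
    rw [map_mul]
    ring
  obtain ⟨Q, hQ, hQP⟩ := (hS P hP).1.prod_le.1 hJ
  exact hanti (Finset.mem_of_mem_erase hQ) hP (Finset.ne_of_mem_erase hQ) hQP

/-- An element outside `M` that is divisible by `w` at every quasi-maximal ideal not containing
`P`. -/
theorem exists_notMem_forall_dvd (hD : s.IsPruferMultiplicationDomain)
    (hfin : s.fin.HasFiniteCharacter) {M P : Ideal D}
    (hM : s.fin.IsQuasiMaximal M) (hP : P.IsPrime) (hPM : P ≤ M) {w : D} (hw : w ∉ P) :
    ∃ c ∉ M, ∀ N, s.fin.IsQuasiMaximal N → ¬ P ≤ N → ∃ t ∉ N, w ∣ t * c := by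
  have hMp := hM.isPrime
  have h1M : (1 : D) ∉ M := fun h => hMp.ne_top ((Ideal.eq_top_iff_one _).2 h)
  have hT := hfin w fun h => hw (h ▸ P.zero_mem)
  have hex : ∀ N : Ideal D, ∃ c ∉ M, ¬ P ≤ N → ∃ t ∉ N, w ∣ t * c := by
    intro N
    by_cases hPN : P ≤ N
    · exact ⟨1, h1M, fun h => (h hPN).elim⟩
    · obtain ⟨p, hp, hpN⟩ := SetLike.not_le_iff_exists.1 hPN
      obtain ⟨t, ht, htp⟩ := hD.exists_dvd_of_mem_of_notMem hM hP hPM hw hp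
      -- The roles swap: `t ∉ M` becomes the factor of `c`, and `p ∉ N` the multiplier at `N`.
      exact ⟨t, ht, fun _ => ⟨p, hpN, by rwa [mul_comm]⟩⟩
  choose f hfM hf using hex
  refine ⟨∏ N ∈ hT.toFinset, f N, fun h => ?_, fun N hN hPN => ?_⟩
  · obtain ⟨N, -, hN⟩ := hMp.prod_mem_iff.1 h
    exact hfM N hN
  · by_cases hwN : w ∈ N
    · obtain ⟨t, ht, htw⟩ := hf N hPN
      exact ⟨t, ht, htw.trans (mul_dvd_mul_left t (Finset.dvd_prod_of_mem f
        (hT.mem_toFinset.2 ⟨hN, hwN⟩)))⟩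
    -- Only the finitely many `N` containing `w` need a factor of `c`; elsewhere `w` is itself a
    -- unit of `D_N`.
    · exact ⟨w, hwN, dvd_mul_right _ _⟩

/-- An ideal whose localization at each quasi-maximal ideal `M` containing it is a prime strictly
below `M` is divisorial. -/
theorem isFinDivisorial_of_forall_lt (hD : s.IsPruferMultiplicationDomain)
    (hfin : s.fin.HasFiniteCharacter) {I : Ideal D} (hI0 : I ≠ ⊥)
    (h : ∀ M, s.fin.IsQuasiMaximal M → I ≤ M →
      ∃ P : Ideal D, P.IsPrime ∧ I ≤ P ∧ P < M ∧ ∀ d ∈ P, ∃ t ∉ M, t * d ∈ I) :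
    s.IsFinDivisorial I := by
  refine isFinDivisorial_of_le fun y hy => ?_
  have hy' : ∀ z : K, (∀ d ∈ I, z * algebraMap D K d ∈ s.fin.cl 1) → y * z ∈ s.fin.cl 1 :=
    fun z hz => by
      rw [fin_cl_one]
      exact Submodule.mem_div_iff_forall_mul_mem.1 hy z ((mem_cl_one_div_iff hI0).2 hz)
  have hD1 : ∀ d : D, algebraMap D K d ∈ s.fin.cl 1 := fun d =>
    s.fin.le_cl 1 one_ne_zero (Submodule.mem_one.2 ⟨d, rfl⟩)
  refine (hD.mem_cl_iff (coeSubmodule_ne_bot hI0)).2 fun M hM => ?_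
  have hMp := hM.isPrime
  have hy1 := hy' 1 fun d _ => by rw [one_mul]; exact hD1 d
  rw [mul_one] at hy1
  obtain ⟨b, hb, hby⟩ := (hD.mem_cl_iff one_ne_zero).1 hy1 M hM
  obtain ⟨a, ha⟩ := Submodule.mem_one.1 hby
  suffices ∃ t ∉ M, t * a ∈ I by
    obtain ⟨t, ht, hta⟩ := this
    refine ⟨t * b, fun h => (hMp.mem_or_mem h).elim ht hb, ?_⟩
    rw [mul_smul, ← ha, Algebra.smul_def, ← map_mul]
    exact algebraMap_mem_coeSubmodule.2 hta
  by_cases hIM : I ≤ M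
  swap
  · obtain ⟨i, hi, hiM⟩ := SetLike.not_le_iff_exists.1 hIM
    exact ⟨i, hiM, I.mul_mem_right _ hi⟩
  obtain ⟨P, hP, hIP, hPM, hPI⟩ := h M hM hIM
  by_cases haP : a ∈ P
  · exact hPI a haP
  exfalso
  -- Locally `y = a / b` with `a ∉ P`. The test element is `z = c / (ax)`: at `N ⊇ P`, `ax` divides
  -- the elements of `I ⊆ P`, and at other `N` it divides `c`, so `zI ⊆ D^⋆`. But `yz = c / (bx)` is
  -- not in `D_M`, as `c ∉ M` and `x ∈ M`.
  obtain ⟨x, hxM, hxP⟩ := SetLike.exists_of_lt hPM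
  have hw : a * x ∉ P := fun h => (hP.mem_or_mem h).elim haP hxP
  have hw0 : algebraMap D K (a * x) ≠ 0 := fun h =>
    hw ((IsFractionRing.injective D K (h.trans (map_zero _).symm)) ▸ P.zero_mem)
  obtain ⟨c, hcM, hc⟩ := hD.exists_notMem_forall_dvd hfin hM hP hPM.le hw
  have hz : ∀ d ∈ I, algebraMap D K c / algebraMap D K (a * x) * algebraMap D K d ∈ s.fin.cl 1 := by
    intro d hd
    refine (hD.mem_cl_iff one_ne_zero).2 fun N hN => ?_
    obtain ⟨t, ht, e, he⟩ : ∃ t ∉ N, a * x ∣ t * (c * d) := by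
      by_cases hPN : P ≤ N
      · obtain ⟨t, ht, htd⟩ := hD.exists_dvd_of_mem_of_notMem hN hP hPN hw (hIP hd)
        exact ⟨t, ht, by rw [mul_left_comm]; exact htd.mul_left c⟩
      · obtain ⟨t, ht, htc⟩ := hc N hN hPN
        exact ⟨t, ht, by rw [← mul_assoc]; exact htc.mul_right d⟩
    refine ⟨t, ht, Submodule.mem_one.2 ⟨e, ?_⟩⟩
    rw [Algebra.smul_def, div_mul_eq_mul_div, mul_div_assoc', ← map_mul, ← map_mul, he, map_mul,
      mul_div_cancel_left₀ _ hw0]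
  obtain ⟨t, ht, hty⟩ := (hD.mem_cl_iff one_ne_zero).1 (hy' _ hz) M hM
  obtain ⟨e, he⟩ := Submodule.mem_one.1 hty
  have ha0 : a ≠ 0 := fun h => haP (h ▸ P.zero_mem)
  have hkey : t * c = e * b * x := by
    refine mul_left_cancel₀ ha0 (IsFractionRing.injective D K ?_)
    rw [Algebra.smul_def, mul_div_assoc', mul_div_assoc', eq_div_iff hw0, map_mul] at he
    rw [Algebra.smul_def] at ha
    simp only [map_mul]
    linear_combination (algebraMap D K t * algebraMap D K c) * ha - algebraMap D K b * he
  have : t * c ∈ M := hkey ▸ M.mul_mem_left _ hxM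
  exact (hMp.mem_or_mem this).elim ht hcM

theorem isFinDivisorial_of_not_isQuasiMaximal (hD : s.IsPruferMultiplicationDomain)
    (hfin : s.fin.HasFiniteCharacter) {P : Ideal D}
    (hP : s.fin.IsQuasiPrime P) (hPM : ¬ s.fin.IsQuasiMaximal P) : s.IsFinDivisorial P :=
  hD.isFinDivisorial_of_forall_lt hfin hP.2.1 fun M hM hle =>
    ⟨P, hP.1, le_rfl, lt_of_le_of_ne hle fun h => hPM (h ▸ hM), fun d hd =>
      ⟨1, fun h => hM.prop.1 ((Ideal.eq_top_iff_one _).2 h), by rwa [one_mul]⟩⟩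

end IsPruferMultiplicationDomain

end Divisorial

end SemistarOperation

/-! ### Assembly of the equivalences -/

open SemistarOperation

theorem mainTheorem4 {D K : Type*} [CommRing D] [IsDomain D] [Field K] [Algebra D K]
    [IsFractionRing D K] (s : SemistarOperation D K)
    (hD : s.IsPruferMultiplicationDomain) (hfin : s.fin.HasFiniteCharacter)
    (I : Ideal D) (hI : s.fin.IsQuasiIdeal I) :
    (s.fin.IsIdempotentIdeal I ↔
      s.fin.IsStarProductOf (fun P => s.fin.IsQuasiPrime P ∧ s.fin.IsIdempotentIdeal P) I) ∧
    List.TFAE [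
      s.fin.IsIdempotentIdeal I ∧ s.IsFinDivisorial I,
      s.fin.IsStarProductOf (fun P => s.fin.IsQuasiPrime P ∧ ¬ s.fin.IsQuasiMaximal P ∧
        s.fin.IsIdempotentIdeal P) I,
      s.fin.IsStarProductOf (fun P => P.IsPrime ∧ P ≠ ⊥ ∧ s.IsFinDivisorial P ∧
        s.fin.IsIdempotentIdeal P) I,
      ∃! S : Finset (Ideal D),
        (∀ P ∈ S, s.fin.IsQuasiPrime P ∧ s.IsFinDivisorial P ∧ s.fin.IsIdempotentIdeal P) ∧
        IsAntichain (· ≤ ·) (S : Set (Ideal D)) ∧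
        s.fin.idealCl I = s.fin.idealCl (∏ P ∈ S, P)] := by
  refine ⟨⟨fun hidem => ?_, fun h => ?_⟩, ?_⟩
  · obtain ⟨S, hS, -, hprod, -⟩ := hD.exists_finset_prod hfin hI.1 hidem
    exact isStarProductOf_finset hS hprod
  · exact hD.isIdempotentIdeal_of_isStarProductOf hI.1 (fun P hP => ⟨hP.1.2.1, hP.2⟩) h
  tfae_have 1 → 4 := by
    rintro ⟨hidem, hdiv⟩
    obtain ⟨S, hS, hanti, hprod, -⟩ := hD.exists_finset_prod hfin hI.1 hidem
    have hS' : ∀ P ∈ S, s.fin.IsQuasiPrime P := fun P hP => (hS P hP).1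
    refine ⟨S, ⟨fun P hP => ⟨hS' P hP, hD.isFinDivisorial_of_not_isQuasiMaximal hfin (hS' P hP)
      (hD.not_isQuasiMaximal_of_isFinDivisorial hI hdiv hS' hanti hprod hP (hS P hP).2),
      (hS P hP).2⟩, hanti, hprod⟩, ?_⟩
    rintro T ⟨hT, hTanti, hTprod⟩
    ext P
    rw [← hI.mem_minimalPrimes_iff (fun P hP => (hT P hP).1) hTanti hTprod,
      ← hI.mem_minimalPrimes_iff hS' hanti hprod]
  tfae_have 4 → 3 := by
    rintro ⟨S, ⟨hS, -, hprod⟩, -⟩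
    exact isStarProductOf_finset (fun P hP => ⟨(hS P hP).1.1, (hS P hP).1.2.1, (hS P hP).2⟩) hprod
  tfae_have 3 → 2 := by
    intro h
    have hidem := hD.isIdempotentIdeal_of_isStarProductOf hI.1
      (fun P hP => ⟨hP.2.1, hP.2.2.2⟩) h
    obtain ⟨S, hS, hanti, hprod, -⟩ := hD.exists_finset_prod hfin hI.1 hidem
    -- The given factors may be redundant or comparable; the canonical incomparable factors occur
    -- among them and inherit their properties.
    have hC := hD.forall_mem_of_isStarProductOf hI (fun P hP => (hS P hP).1) hanti hprod
      (fun P hP => ⟨hP.1, hP.2.1⟩) h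
    exact isStarProductOf_finset (fun P hP => ⟨(hS P hP).1, fun hPM =>
      hD.not_isFinDivisorial_of_isQuasiMaximal hPM (hS P hP).2 (hC P hP).2.2.1, (hS P hP).2⟩) hprod
  tfae_have 2 → 1 := by
    intro h
    have hidem := hD.isIdempotentIdeal_of_isStarProductOf hI.1
      (fun P hP => ⟨hP.1.2.1, hP.2.2⟩) h
    obtain ⟨S, hS, hanti, hprod, hloc⟩ := hD.exists_finset_prod hfin hI.1 hidem
    have hC := hD.forall_mem_of_isStarProductOf hI (fun P hP => (hS P hP).1) hanti hprod
      (fun P hP => ⟨hP.1.1, hP.1.2.1⟩) h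
    refine ⟨hidem, hD.isFinDivisorial_of_forall_lt hfin hI.1 fun M hM hIM => ?_⟩
    obtain ⟨P, hP, hIP, hPM, hPI⟩ := hloc M hM hIM
    exact ⟨P, (hS P hP).1.1, hIP, lt_of_le_of_ne hPM fun h => (hC P hP).2.1 (h ▸ hM), hPI⟩
  tfae_finish
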